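/- **Lemma (typical error components are small for the thermal state of quantum locally testable codes).** Let $\mathcal P=\{I,X,Y,Z\}$, and for a Pauli word $P\in\mathcal P^n$ let $\mathrm{wt}(P)$ be the number of its non-identity factors and $\mathrm{supp}(P)$ the set of qubits carrying them. Let $S$ be a finite set (no repetitions) of pairwise commuting signed Pauli words $\pm P$ on $n$ qubits, the checks, generating a stabilizer group $\mathcal G\not\ni -I$, with code space the joint $1$-eigenspace of $\mathcal G$. Let $C[\mathcal G]\subseteq\mathcal P^n$ be the set of Pauli words commuting with $\mathcal G$, and let $|P|=\min_{z\in C[\mathcal G]}\mathrm{wt}(P\cdot z)$ (products up to phase). For $s>0$ the code is a $(q,s)$-stabilizer LTC if every check has weight at most $q$ and, for every $P\in\mathcal P^n$, a uniformly random check $g\in S$ satisfies $\Pr([g,P]\ne 0)\ge s\,|P|/n$. Put $m=|S|$, $H=\sum_{g\in S}(I-g)/2$ and $\lambda=m/n$. The interaction graph $G(H)$ has the $n$ qubits as vertices, two distinct qubits being adjacent if some check acts nontrivially on both. For $\alpha>0$ and a set $X$ of qubits, let $\mathrm{maxconn}_\alpha(X)$ be the maximal size of a set $T$ of qubits that is connected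 in $G(H)$ and satisfies $|T\cap X|\ge\alpha|T|$ (and $0$ if there is none). Let $\tau_0$ be the uniform mixture on the code space, i.e. the normalized projection onto it. There is an absolute constant $n_0$ such that the following holds for all $n\ge n_0$. Let a $(q,s)$-stabilizer LTC on $n$ qubits with $s>0$ be given, whose interaction graph has maximum degree at most $D$, let $\alpha>0$, and let $$\frac{10}{\alpha}\cdot\frac{\ln D}{s}\;\le\;\beta\;\le\;\frac{\lambda}{\ln n}.$$ Let $\mathcal E\in\mathcal P^n$ be a random error that always has minimal weight, $\mathrm{wt}(\mathcal E)=|\mathcal E|$, and for which the random state $\tau=\mathcal E\,\tau_0\,\mathcal E$ is distributed according to the Gibbs state, i.e. $\mathbb E[\mathcal E\,\tau_0\,\mathcal E]=e^{-\beta H/\lambda}/Z$ with $Z=\mathrm{tr}\,e^{-\beta H/\lambda}$. Then $$\Pr\Big(\mathrm{maxconn}_\alpha(\mathrm{supp}(\mathcal E))>\frac{\ln n}{100}\Big)\le n^{-3}.$$ (For $D=0$ the convention $\ln 0=0$ is used, i.e. the lower bound is $\beta\ge 0$.) -/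

import Mathlib

/-! Stabilizer codes, local testability, thermal Gibbs states and `α`-connected components. -/

namespace ThermalLTC

noncomputable section

/-- Single-qubit Pauli operators up to phase, written additively:
`I = (0,0)`, `X = (1,0)`, `Z = (0,1)`, `Y = (1,1)`. -/
abbrev Pauli : Type := ZMod 2 × ZMod 2

/-- The `2 × 2` matrix of a single-qubit Pauli operator. -/
def pauliMatrix (p : Pauli) : Matrix (Fin 2) (Fin 2) ℂ :=
  if p = (0, 0) then 1
  else if p = (1, 0) then !![0, 1; 1, 0]
  else if p = (0, 1) then !![1, 0; 0, -1]
  else !![0, -Complex.I; Complex.I, 0]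

/-- Pauli words `E₁ ⊗ ⋯ ⊗ Eₙ` with `Eᵢ ∈ {I, X, Y, Z}`; the sum of two words is their product
up to phase. -/
abbrev PauliWord (n : ℕ) : Type := Fin n → Pauli

/-- Operators on `n` qubits, in the computational basis `{0,1}ⁿ`. -/
abbrev QubitOp (n : ℕ) : Type := Matrix (Fin n → Fin 2) (Fin n → Fin 2) ℂ

/-- The tensor product operator `E₁ ⊗ ⋯ ⊗ Eₙ` on `(ℂ²)^{⊗ n}`. -/
def wordOp {n : ℕ} (E : PauliWord n) : QubitOp n :=
  Matrix.of fun x y => ∏ i, pauliMatrix (E i) (x i) (y i)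

/-- The qubits on which a Pauli word is not the identity. -/
def supp {n : ℕ} (E : PauliWord n) : Finset (Fin n) :=
  Finset.univ.filter fun i => E i ≠ 0

/-- Hamming weight of a Pauli word. -/
def wt {n : ℕ} (E : PauliWord n) : ℕ := (supp E).card

/-- A Hermitian Pauli operator: a sign together with a Pauli word. -/
abbrev SignedPauli (n : ℕ) : Type := ℤˣ × PauliWord n

/-- The operator of a signed Pauli word. -/
def signedOp {n : ℕ} (g : SignedPauli n) : QubitOp n :=
  (((g.1 : ℤˣ) : ℤ) : ℂ) • wordOp g.2

/-- The stabilizer group generated by a set of checks (the checks are involutions, so the monoid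
that they generate is a group). -/
def stabGroup {n : ℕ} (S : Finset (SignedPauli n)) : Submonoid (QubitOp n) :=
  Submonoid.closure (signedOp '' (S : Set (SignedPauli n)))

/-- The code space: the mutual `1`-eigenspace of the stabilizer group. -/
def codeSpace {n : ℕ} (S : Finset (SignedPauli n)) :
    Submodule ℂ (EuclideanSpace ℂ (Fin n → Fin 2)) :=
  ⨅ g ∈ stabGroup S, Module.End.eigenspace (Matrix.toEuclideanLin g) 1

/-- `S` is the set of check terms of a stabilizer code: the checks commute in pairs, and the
code space is not zero (equivalently, the group generated by `S` does not contain `-1`). -/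
def IsStabilizerCode {n : ℕ} (S : Finset (SignedPauli n)) : Prop :=
  (∀ g ∈ S, ∀ h ∈ S, Commute (signedOp g) (signedOp h)) ∧ codeSpace S ≠ ⊥

/-- The Pauli words in the centralizer of the stabilizer group. -/
def centralizer {n : ℕ} (S : Finset (SignedPauli n)) : Set (PauliWord n) :=
  {z | ∀ g ∈ stabGroup S, Commute g (wordOp z)}

/-- The weight of `P` modulo the centralizer, `min_z wt (P + z)`. -/
def wtMod {n : ℕ} (S : Finset (SignedPauli n)) (P : PauliWord n) : ℕ :=
  sInf ((fun z => wt (P + z)) '' centralizer S)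

/-- An error of minimal weight in its class modulo the centralizer. -/
def IsMinimalError {n : ℕ} (S : Finset (SignedPauli n)) (E : PauliWord n) : Prop :=
  wt E = wtMod S E

open Classical in
/-- The stabilizer code with check set `S` is a `(q, s)`-stabilizer locally testable code:
the checks are `q`-local, and for every Pauli word `P` a uniformly random check fails to commute
with `P` with probability at least `s · |P| / n`. -/
def IsSLTC {n : ℕ} (S : Finset (SignedPauli n)) (q : ℕ) (s : ℝ) : Prop :=
  IsStabilizerCode S ∧
  (∀ g ∈ S, wt g.2 ≤ q) ∧
  ∀ P : PauliWord n,
    ((wtMod S P : ℝ) / n) * s ≤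
      ((S.filter fun g => ¬ Commute (signedOp g) (wordOp P)).card : ℝ) / S.card

/-- The Hamiltonian `H = ∑_g (1 - g) / 2`, summed over the checks. -/
def hamiltonian {n : ℕ} (S : Finset (SignedPauli n)) : QubitOp n :=
  ∑ g ∈ S, (1 / 2 : ℂ) • (1 - signedOp g)

/-- The energy density `λ = m / n` of the Hamiltonian, with `m` the number of checks. -/
def energyDensity {n : ℕ} (S : Finset (SignedPauli n)) : ℝ := (S.card : ℝ) / n

/-- The Gibbs state `e^{-β H / λ} / Z`, `Z = tr e^{-β H / λ}`. -/
def gibbs {n : ℕ} (S : Finset (SignedPauli n)) (β : ℝ) : QubitOp n :=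
  (Matrix.trace (NormedSpace.exp (((-(β / energyDensity S) : ℝ) : ℂ) • hamiltonian S)))⁻¹ •
    NormedSpace.exp (((-(β / energyDensity S) : ℝ) : ℂ) • hamiltonian S)

/-- The orthogonal projection onto the code space, as a matrix. -/
def codeProj {n : ℕ} (S : Finset (SignedPauli n)) : QubitOp n :=
  (Matrix.toEuclideanCLM (n := Fin n → Fin 2) (𝕜 := ℂ)).symm (codeSpace S).starProjection

/-- The uniform mixture `τ₀` on the code space. -/
def codeState {n : ℕ} (S : Finset (SignedPauli n)) : QubitOp n :=
  (Matrix.trace (codeProj S))⁻¹ • codeProj S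

/-- `μ` is the law of a random error `E` of minimal weight such that the random state
`τ = E τ₀ E` is distributed according to the Gibbs state, that is, the mixture of the states
`E τ₀ E` is `e^{-β H / λ} / Z`. (States `E τ₀ E` that are different are orthogonal, so that this
fixes the law of `τ`; only the choice between errors of minimal weight that give the same
state `τ` is left free.) -/
def IsGibbsErrorLaw {n : ℕ} (S : Finset (SignedPauli n)) (β : ℝ) (μ : PMF (PauliWord n)) : Prop :=
  (∀ E ∈ μ.support, IsMinimalError S E) ∧
  ∑ E : PauliWord n, (((μ E).toReal : ℝ) : ℂ) • (wordOp E * codeState S * wordOp E) = gibbs S β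

/-- The interaction graph: two different qubits are adjacent if some check acts on both. -/
def interactionGraph {n : ℕ} (S : Finset (SignedPauli n)) : SimpleGraph (Fin n) where
  Adj i j := i ≠ j ∧ ∃ g ∈ S, i ∈ supp g.2 ∧ j ∈ supp g.2
  symm := ⟨fun _ _ h => ⟨h.1.symm, h.2.imp fun _ hg => ⟨hg.1, hg.2.2, hg.2.1⟩⟩⟩
  loopless := ⟨fun _ h => h.1 rfl⟩

/-- `T` is an `α`-subset of `X`: `|T ∩ X| ≥ α |T|`. -/
def IsAlphaSubset {V : Type*} [DecidableEq V] (α : ℝ) (X T : Finset V) : Prop :=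
  α * (T.card : ℝ) ≤ ((T ∩ X).card : ℝ)

open Classical in
/-- The maximal size of a connected `α`-subset of `X` (`0` if there is none). -/
def maxconn {V : Type*} [Fintype V] [DecidableEq V] (G : SimpleGraph V) (α : ℝ)
    (X : Finset V) : ℕ :=
  (Finset.univ.filter fun T : Finset V =>
    (G.induce (T : Set V)).Connected ∧ IsAlphaSubset α X T).sup Finset.card

end

end ThermalLTC

/-! A Peierls argument. The Gibbs state makes the probability of a syndrome proportional to
`exp (-(β / λ) * number of violated checks)`. If `T` is a maximal connected `α`-subset of the
support of an error `E`, no vertex of `supp E` outside `T` is adjacent to `T`, so no check meets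
both `E|_T` and the rest of `E`, and removing `E|_T` removes exactly the checks it violates. By
local testability there are at least `s * λ * α * |T|` of them, so the probability gains a factor
at least `D ^ (10 * |T|)`. For a fixed `T` the removed syndrome takes at most `4 ^ |T|` values,
and at most `n * D ^ (2 * |T|)` connected sets have a given size, because each is swept out by a
closed walk; the gain beats both counts once `D` is large.

That `D` is large follows from the upper bound on `β`: at most `2 * 4 ^ (D + 1)` checks act on a
given qubit, so a single-qubit error forces `s * λ ≤ 2 * 4 ^ (D + 1)`, and then the two bounds on
`β` are compatible with a large connected set only if `log n ≤ 2 * 4 ^ (D + 1)`.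
-/

namespace ThermalLTC

section ConnectedSets

open Finset SimpleGraph

variable {V : Type*} {G : SimpleGraph V}

lemma card_finsetWalkLength_le [DecidableEq V] [G.LocallyFinite] {D : ℕ}
    (hD : ∀ v, G.degree v ≤ D) (k : ℕ) (u v : V) : #(G.finsetWalkLength k u v) ≤ D ^ k := by
  induction k generalizing u with
  | zero =>
    rw [finsetWalkLength]
    split_ifs with huv
    · subst huv
      simp
    · simp
  | succ k ih =>
    calc #(G.finsetWalkLength (k + 1) u v)
        ≤ ∑ _w : G.neighborSet u, D ^ k :=
          card_biUnion_le.trans (sum_le_sum fun w _ => (card_map _).trans_le (ih w))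
      _ = G.degree u * D ^ k := by
          rw [sum_const, smul_eq_mul, card_univ, G.card_neighborSet_eq_degree]
      _ ≤ D ^ (k + 1) := by
          rw [pow_succ']
          exact Nat.mul_le_mul_right _ (hD u)

lemma exists_walk_support_eq_insert [DecidableEq V] {a b u w : V} (p : G.Walk a b)
    (hu : u ∈ p.support) (huw : G.Adj u w) :
    ∃ p' : G.Walk a b, p'.length = p.length + 2 ∧
      p'.support.toFinset = insert w p.support.toFinset := by
  refine ⟨(p.takeUntil u hu).append (.cons huw (.cons huw.symm (p.dropUntil u hu))), ?_, ?_⟩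
  · have hlen := congrArg Walk.length (p.take_spec hu)
    simp only [Walk.length_append, Walk.length_cons] at hlen ⊢
    lia
  · have hsupp : ∀ x, x ∈ p.support ↔
        x ∈ (p.takeUntil u hu).support ∨ x ∈ (p.dropUntil u hu).support := fun x => by
      rw [← Walk.mem_support_append_iff, p.take_spec hu]
    ext x
    simp only [List.mem_toFinset, Walk.mem_support_append_iff, Walk.support_cons, List.mem_cons,
      mem_insert, hsupp]
    have := (p.takeUntil u hu).end_mem_support
    grind

lemma exists_adj_of_connected_induce {T : Set V} (hT : (G.induce T).Connected) {A : Set V}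
    {a b : V} (haT : a ∈ T) (haA : a ∈ A) (hbT : b ∈ T) (hbA : b ∉ A) :
    ∃ u ∈ A, ∃ w ∈ T, w ∉ A ∧ G.Adj u w := by
  obtain ⟨p⟩ := hT.preconnected ⟨a, haT⟩ ⟨b, hbT⟩
  obtain ⟨d, -, hdA, hdA'⟩ := p.exists_boundary_dart (Subtype.val ⁻¹' A) haA hbA
  exact ⟨d.fst, hdA, d.snd, d.snd.2, hdA', d.adj⟩

lemma exists_closed_walk_support_eq [DecidableEq V] {T : Finset V}
    (hT : (G.induce (T : Set V)).Connected) {v : V} (hv : v ∈ T) :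
    ∃ p : G.Walk v v, p.length = 2 * (#T - 1) ∧ p.support.toFinset = T := by
  have grow : ∀ k < #T, ∃ p : G.Walk v v,
      p.length = 2 * k ∧ p.support.toFinset ⊆ T ∧ #p.support.toFinset = k + 1 := by
    intro k
    induction k with
    | zero => exact fun _ => ⟨.nil, by simpa using hv⟩
    | succ k ih =>
      intro hk
      obtain ⟨p, hlen, hsub, hcard⟩ := ih (by lia)
      obtain ⟨b, hbT, hb⟩ := exists_mem_notMem_of_card_lt_card (hcard.trans_lt hk)
      obtain ⟨u, hu, w, hwT, hw, huw⟩ := exists_adj_of_connected_induce hT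
        (A := p.support.toFinset) hv (by simp) hbT hb
      obtain ⟨p', hlen', hsupp'⟩ := exists_walk_support_eq_insert p (List.mem_toFinset.1 hu) huw
      refine ⟨p', by lia, ?_, ?_⟩
      · rw [hsupp']
        exact insert_subset hwT hsub
      · rw [hsupp', card_insert_of_notMem hw, hcard]
  have hpos : 0 < #T := card_pos.2 ⟨v, hv⟩
  obtain ⟨p, hlen, hsub, hcard⟩ := grow (#T - 1) (by lia)
  exact ⟨p, hlen, eq_of_subset_of_card_le hsub (by lia)⟩

lemma IsAlphaSubset.le_one [DecidableEq V] {α : ℝ} {X T : Finset V}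
    (h : IsAlphaSubset α X T) (hT : T.Nonempty) : α ≤ 1 := by
  have hinter : ((#(T ∩ X) : ℕ) : ℝ) ≤ #T := mod_cast card_le_card inter_subset_left
  have hpos : (0 : ℝ) < #T := mod_cast hT.card_pos
  exact le_of_mul_le_mul_right (by simpa using h.trans hinter) hpos

lemma IsAlphaSubset.insert [DecidableEq V] {α : ℝ} (hα : α ≤ 1) {X T : Finset V}
    (h : IsAlphaSubset α X T) {w : V} (hwX : w ∈ X) (hwT : w ∉ T) :
    IsAlphaSubset α X (insert w T) := by
  rw [IsAlphaSubset, insert_inter_of_mem hwX, card_insert_of_notMem hwT,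
    card_insert_of_notMem fun hw => hwT (mem_inter.1 hw).1]
  push_cast
  linarith [show α * (#T : ℝ) ≤ #(T ∩ X) from h]

open Classical in
/-- The vertex sets that induce a connected subgraph of `G`. -/
noncomputable def connectedSets [Fintype V] (G : SimpleGraph V) : Finset (Finset V) :=
  {T | (G.induce (T : Set V)).Connected}

lemma mem_connectedSets [Fintype V] {T : Finset V} :
    T ∈ connectedSets G ↔ (G.induce (T : Set V)).Connected := by
  simp [connectedSets]

lemma nonempty_of_mem_connectedSets [Fintype V] {T : Finset V} (hT : T ∈ connectedSets G) :
    T.Nonempty :=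
  nonempty_coe_sort.1 (mem_connectedSets.1 hT).nonempty

variable [Fintype V]

lemma card_connectedSets_mem_card_eq_le [DecidableEq V] [G.LocallyFinite] {D : ℕ}
    (hD : ∀ v, G.degree v ≤ D) (v : V) (t : ℕ) :
    #{T ∈ connectedSets G | v ∈ T ∧ #T = t} ≤ D ^ (2 * (t - 1)) := by
  have hsub : {T ∈ connectedSets G | v ∈ T ∧ #T = t} ⊆
      (G.finsetWalkLength (2 * (t - 1)) v v).image fun p => p.support.toFinset := fun T hT => by
    obtain ⟨hT, hv, hcard⟩ := mem_filter.1 hT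
    obtain ⟨p, hlen, hsupp⟩ := exists_closed_walk_support_eq (mem_connectedSets.1 hT) hv
    rw [hcard] at hlen
    exact mem_image.2 ⟨p, mem_finsetWalkLength_iff.2 hlen, hsupp⟩
  exact (card_le_card hsub).trans (card_image_le.trans (card_finsetWalkLength_le hD _ v v))

lemma sum_connectedSets_mem_inv_pow_le [DecidableEq V] [G.LocallyFinite] {D : ℕ}
    (hD : ∀ v, G.degree v ≤ D) (v : V) :
    ∑ T ∈ connectedSets G with v ∈ T, ((D : ℝ) ^ (2 * (#T - 1)))⁻¹ ≤ Fintype.card V := by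
  have hmaps : ∀ T ∈ {T ∈ connectedSets G | v ∈ T}, #T ∈ Icc 1 (Fintype.card V) := fun T hT =>
    mem_Icc.2 ⟨card_pos.2 ⟨v, (mem_filter.1 hT).2⟩, card_le_univ T⟩
  have sum_card_eq_le (t : ℕ) :
      ∑ T ∈ connectedSets G with v ∈ T ∧ #T = t, ((D : ℝ) ^ (2 * (#T - 1)))⁻¹ ≤ 1 := by
    rw [sum_congr rfl fun T hT => by rw [(mem_filter.1 hT).2.2], sum_const, nsmul_eq_mul]
    calc (#{T ∈ connectedSets G | v ∈ T ∧ #T = t} : ℝ) * ((D : ℝ) ^ (2 * (t - 1)))⁻¹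
        ≤ (D : ℝ) ^ (2 * (t - 1)) * ((D : ℝ) ^ (2 * (t - 1)))⁻¹ := by
          gcongr
          exact_mod_cast card_connectedSets_mem_card_eq_le hD v t
      _ ≤ 1 := mul_inv_le_one
  calc ∑ T ∈ connectedSets G with v ∈ T, ((D : ℝ) ^ (2 * (#T - 1)))⁻¹
      = ∑ t ∈ Icc 1 (Fintype.card V),
          ∑ T ∈ connectedSets G with v ∈ T ∧ #T = t, ((D : ℝ) ^ (2 * (#T - 1)))⁻¹ := by
        rw [← sum_fiberwise_of_maps_to hmaps]
        simp only [filter_filter]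
    _ ≤ ∑ _t ∈ Icc 1 (Fintype.card V), (1 : ℝ) := sum_le_sum fun t _ => sum_card_eq_le t
    _ = Fintype.card V := by simp

lemma sum_connectedSets_inv_pow_le [G.LocallyFinite] {D : ℕ} (hD : ∀ v, G.degree v ≤ D) :
    ∑ T ∈ connectedSets G, ((D : ℝ) ^ (2 * (#T - 1)))⁻¹ ≤ (Fintype.card V : ℝ) ^ 2 := by
  classical
  calc ∑ T ∈ connectedSets G, ((D : ℝ) ^ (2 * (#T - 1)))⁻¹
      ≤ ∑ T ∈ connectedSets G, ∑ _v ∈ T, ((D : ℝ) ^ (2 * (#T - 1)))⁻¹ :=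
        sum_le_sum fun T hT => by
          obtain ⟨v, hv⟩ := nonempty_of_mem_connectedSets hT
          exact single_le_sum (f := fun _ => ((D : ℝ) ^ (2 * (#T - 1)))⁻¹)
            (fun _ _ => by positivity) hv
    _ = ∑ v, ∑ T ∈ connectedSets G with v ∈ T, ((D : ℝ) ^ (2 * (#T - 1)))⁻¹ :=
        sum_comm' (by simp)
    _ ≤ ∑ _v : V, (Fintype.card V : ℝ) :=
        sum_le_sum fun v _ => sum_connectedSets_mem_inv_pow_le hD v
    _ = (Fintype.card V : ℝ) ^ 2 := by simp [sq]

lemma sum_connectedSets_pow_le [G.LocallyFinite] {D : ℕ} (hG : ∀ v, G.degree v ≤ D)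
    (hD : 0 < D) {x y L : ℝ} (hx : 0 ≤ x) (hy : 0 ≤ y)
    (hxy : ∀ t : ℕ, L < t → (x * D ^ 2) ^ t ≤ y) :
    ∑ T ∈ connectedSets G with L < (#T : ℝ), x ^ #T ≤ y * Fintype.card V ^ 2 := by
  have hterm : ∀ T : Finset V, L < (#T : ℝ) →
      x ^ #T ≤ y * ((D : ℝ) ^ (2 * (#T - 1)))⁻¹ := by
    intro T hTL
    have hD' : (1 : ℝ) ≤ D := by exact_mod_cast hD
    rw [← div_eq_mul_inv, le_div_iff₀ (by positivity)]
    calc x ^ #T * (D : ℝ) ^ (2 * (#T - 1)) ≤ x ^ #T * (D : ℝ) ^ (2 * #T) := by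
          gcongr
          exact Nat.sub_le _ _
      _ = (x * D ^ 2) ^ #T := by rw [mul_pow, pow_mul]
      _ ≤ y := hxy _ hTL
  calc ∑ T ∈ connectedSets G with L < (#T : ℝ), x ^ #T
      ≤ ∑ T ∈ connectedSets G with L < (#T : ℝ), y * ((D : ℝ) ^ (2 * (#T - 1)))⁻¹ :=
        sum_le_sum fun T hT => hterm T (mem_filter.1 hT).2
    _ ≤ ∑ T ∈ connectedSets G, y * ((D : ℝ) ^ (2 * (#T - 1)))⁻¹ :=
        sum_le_sum_of_subset_of_nonneg (filter_subset _ _) fun _ _ _ => by positivity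
    _ ≤ y * Fintype.card V ^ 2 := by
        rw [← mul_sum]
        exact mul_le_mul_of_nonneg_left (sum_connectedSets_inv_pow_le hG) hy

lemma two_mul_card_le_of_connected [DecidableRel G.Adj] {D : ℕ}
    (hG : G.Connected) (hD : ∀ v, G.degree v ≤ D) :
    2 * Fintype.card V ≤ D * Fintype.card V + 2 := by
  classical
  have hedges : Fintype.card V ≤ #G.edgeFinset + 1 := by
    have hcard := hG.card_vert_le_card_edgeSet_add_one
    rwa [Nat.card_eq_fintype_card, Nat.card_eq_fintype_card, ← edgeFinset_card] at hcard
  have hdeg : ∑ v, G.degree v ≤ Fintype.card V * D := by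
    simpa using sum_le_card_nsmul univ _ D fun v _ => hD v
  rw [G.sum_degrees_eq_twice_card_edges] at hdeg
  lia

lemma card_le_two_of_mem_connectedSets [G.LocallyFinite] (hG : ∀ v, G.degree v ≤ 1)
    {T : Finset V} (hT : T ∈ connectedSets G) : #T ≤ 2 := by
  classical
  have hdeg : ∀ v, (G.induce (T : Set V)).degree v ≤ 1 := fun v =>
    ((Copy.induce G (T : Set V)).degree_le v).trans (hG _)
  have := two_mul_card_le_of_connected (mem_connectedSets.1 hT) hdeg
  rw [show Fintype.card (T : Set V) = #T from Fintype.card_coe T] at this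
  lia

lemma insert_mem_connectedSets [DecidableEq V] {T : Finset V} (hT : T ∈ connectedSets G)
    {u w : V} (hu : u ∈ T) (huw : G.Adj u w) : insert w T ∈ connectedSets G := by
  have hunion : ((insert w T : Finset V) : Set V) = (T : Set V) ∪ {u, w} := by
    ext x
    simp only [coe_insert, Set.mem_insert_iff, mem_coe, Set.mem_union, Set.mem_singleton_iff]
    grind
  rw [mem_connectedSets, hunion]
  exact induce_union_connected (mem_connectedSets.1 hT).preconnected
    (induce_pair_connected_of_adj huw).preconnected ⟨u, hu, by simp⟩

lemma exists_maximal_of_lt_maxconn [DecidableEq V] {α L : ℝ} {X : Finset V} (hL : 0 ≤ L)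
    (h : L < maxconn G α X) :
    ∃ T : Finset V, L < #T ∧ Maximal (fun T => T ∈ connectedSets G ∧ IsAlphaSubset α X T) T := by
  classical
  have hpos : 0 < maxconn G α X := mod_cast hL.trans_lt h
  have hne : ({T | (G.induce (T : Set V)).Connected ∧ IsAlphaSubset α X T} :
      Finset (Finset V)).Nonempty := by
    by_contra hempty
    simp [maxconn, not_nonempty_iff_eq_empty.1 hempty] at hpos
  obtain ⟨T, hT, hcard⟩ := exists_mem_eq_sup _ hne card
  simp only [mem_filter_univ, ← mem_connectedSets] at hT
  refine ⟨T, h.trans_eq (congrArg _ hcard), hT, fun U hU hTU => ?_⟩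
  have hle : #U ≤ maxconn G α X :=
    le_sup (f := card) (mem_filter_univ U |>.2 ⟨mem_connectedSets.1 hU.1, hU.2⟩)
  exact (eq_of_subset_of_card_le hTU (hle.trans_eq hcard)).ge

lemma not_adj_of_maximal [DecidableEq V] {α : ℝ} {X T : Finset V}
    (hT : Maximal (fun T => T ∈ connectedSets G ∧ IsAlphaSubset α X T) T) {u w : V}
    (hu : u ∈ T) (hwX : w ∈ X) (hwT : w ∉ T) : ¬ G.Adj u w := fun huw =>
  have hα : α ≤ 1 := hT.prop.2.le_one ⟨u, hu⟩
  hwT <| hT.le_of_ge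
    ⟨insert_mem_connectedSets hT.prop.1 hu huw, hT.prop.2.insert hα hwX hwT⟩
    (subset_insert w T) (mem_insert_self w T)

end ConnectedSets

section PiKronecker

open scoped Matrix

variable {ι R : Type*} [CommSemiring R] {l m n : ι → Type*}

/-- The Kronecker product `⨂ i, M i` of a finite family of matrices; its rows and columns are
indexed by families of indices. -/
def piKronecker [Fintype ι] (M : ∀ i, Matrix (m i) (n i) R) : Matrix (∀ i, m i) (∀ i, n i) R :=
  Matrix.of fun x y => ∏ i, M i (x i) (y i)

lemma piKronecker_mul [Fintype ι] [DecidableEq ι] [∀ i, Fintype (m i)]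
    (M : ∀ i, Matrix (l i) (m i) R) (N : ∀ i, Matrix (m i) (n i) R) :
    piKronecker M * piKronecker N = piKronecker fun i => M i * N i := by
  ext x z
  simp only [piKronecker, Matrix.mul_apply, Matrix.of_apply, ← Finset.prod_mul_distrib]
  rw [Finset.prod_univ_sum, Fintype.piFinset_univ]

lemma piKronecker_one [Fintype ι] [∀ i, DecidableEq (m i)] :
    piKronecker (fun i => (1 : Matrix (m i) (m i) R)) = 1 := by
  ext x y
  by_cases h : x = y
  · subst h
    simp [piKronecker]
  · obtain ⟨i, hi⟩ := Function.ne_iff.1 h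
    rw [Matrix.one_apply_ne h]
    exact Finset.prod_eq_zero (Finset.mem_univ i) (Matrix.one_apply_ne hi)

lemma piKronecker_smul [Fintype ι] {K : Type*} [CommMonoid K] [MulAction K R]
    [IsScalarTower K R R] [SMulCommClass K R R] (c : ι → K) (M : ∀ i, Matrix (m i) (n i) R) :
    piKronecker (fun i => c i • M i) = (∏ i, c i) • piKronecker M := by
  ext x y
  exact Finset.prod_smul ..

lemma conjTranspose_piKronecker [Fintype ι] [StarRing R] (M : ∀ i, Matrix (m i) (n i) R) :
    (piKronecker M)ᴴ = piKronecker fun i => (M i)ᴴ := by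
  ext x y
  exact star_prod ..

end PiKronecker

section Pauli

open scoped Matrix

instance {m n R : Type*} [AddMonoid R] [IsAddTorsionFree R] : IsAddTorsionFree (Matrix m n R) :=
  inferInstanceAs (IsAddTorsionFree (m → n → R))

/-- The sign `ε` such that `p q = ε q p` for the single-qubit Pauli operators `p` and `q`. It is
the parity of the symplectic form of `(𝔽₂)²`. -/
def pauliSign (p q : Pauli) : ℤˣ := if p.1 * q.2 + p.2 * q.1 = 0 then 1 else -1

lemma pauliSign_zero_left (q : Pauli) : pauliSign 0 q = 1 := by
  revert q
  decide

lemma pauliSign_zero_right (p : Pauli) : pauliSign p 0 = 1 := by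
  revert p
  decide

lemma pauliSign_add_right (p q r : Pauli) :
    pauliSign p (q + r) = pauliSign p q * pauliSign p r := by
  revert p q r
  decide

lemma pauli_cases (p : Pauli) : p = (0, 0) ∨ p = (1, 0) ∨ p = (0, 1) ∨ p = (1, 1) := by
  revert p
  decide

lemma pauliMatrix_mul_comm (p q : Pauli) :
    pauliMatrix p * pauliMatrix q = pauliSign p q • (pauliMatrix q * pauliMatrix p) := by
  rcases pauli_cases p with rfl | rfl | rfl | rfl <;>
    rcases pauli_cases q with rfl | rfl | rfl | rfl <;>
    simp [pauliMatrix, pauliSign, CharTwo.add_self_eq_zero, Units.smul_def]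

lemma pauliMatrix_mul_self (p : Pauli) : pauliMatrix p * pauliMatrix p = 1 := by
  rcases pauli_cases p with rfl | rfl | rfl | rfl <;> simp [pauliMatrix, Matrix.one_fin_two]

lemma conjTranspose_pauliMatrix (p : Pauli) : (pauliMatrix p)ᴴ = pauliMatrix p := by
  rcases pauli_cases p with rfl | rfl | rfl | rfl <;> ext i j <;> fin_cases i <;> fin_cases j <;>
    simp [pauliMatrix]

variable {n : ℕ}

lemma wordOp_eq_piKronecker (E : PauliWord n) :
    wordOp E = piKronecker fun i => pauliMatrix (E i) := rfl

lemma wordOp_mul_self (E : PauliWord n) : wordOp E * wordOp E = 1 := by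
  simp only [wordOp_eq_piKronecker, piKronecker_mul, pauliMatrix_mul_self, piKronecker_one]

lemma conjTranspose_wordOp (E : PauliWord n) : (wordOp E)ᴴ = wordOp E := by
  simp only [wordOp_eq_piKronecker, conjTranspose_piKronecker, conjTranspose_pauliMatrix]

/-- The sign `ε` such that `E F = ε F E` for the operators of the Pauli words `E` and `F`. -/
def wordSign (E F : PauliWord n) : ℤˣ := ∏ i, pauliSign (E i) (F i)

lemma wordSign_add_right (E F F' : PauliWord n) :
    wordSign E (F + F') = wordSign E F * wordSign E F' := by
  simp only [wordSign, Pi.add_apply, pauliSign_add_right, Finset.prod_mul_distrib]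

lemma mem_supp {E : PauliWord n} {i : Fin n} : i ∈ supp E ↔ E i ≠ 0 := by
  simp [supp]

lemma wordSign_eq_one_of_disjoint {E F : PauliWord n} (h : Disjoint (supp E) (supp F)) :
    wordSign E F = 1 := by
  refine Finset.prod_eq_one fun i _ => ?_
  by_cases hE : E i = 0
  · rw [hE, pauliSign_zero_left]
  · have hF : F i = 0 := by
      simpa [mem_supp] using Finset.disjoint_left.1 h (mem_supp.2 hE)
    rw [hF, pauliSign_zero_right]

lemma wordOp_mul_comm (E F : PauliWord n) :
    wordOp E * wordOp F = wordSign E F • (wordOp F * wordOp E) := by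
  simp only [wordOp_eq_piKronecker, piKronecker_mul, wordSign, ← piKronecker_smul,
    ← pauliMatrix_mul_comm]

lemma signedOp_eq_smul (g : SignedPauli n) : signedOp g = g.1 • wordOp g.2 := by
  rw [signedOp, Int.cast_smul_eq_zsmul, Units.smul_def]

lemma signedOp_mul_self (g : SignedPauli n) : signedOp g * signedOp g = 1 := by
  rw [signedOp_eq_smul, smul_mul_smul_comm, wordOp_mul_self, Int.units_mul_self, one_smul]

lemma conjTranspose_signedOp (g : SignedPauli n) : (signedOp g)ᴴ = signedOp g := by
  simp [signedOp, Matrix.conjTranspose_smul, conjTranspose_wordOp]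

lemma signedOp_mul_wordOp (g : SignedPauli n) (E : PauliWord n) :
    signedOp g * wordOp E = wordSign g.2 E • (wordOp E * signedOp g) := by
  rw [signedOp_eq_smul, smul_mul_assoc, wordOp_mul_comm, mul_smul_comm, smul_comm]

lemma commute_signedOp_wordOp_iff {g : SignedPauli n} {E : PauliWord n} :
    Commute (signedOp g) (wordOp E) ↔ wordSign g.2 E = 1 := by
  have hne : wordOp E * signedOp g ≠ 0 :=
    ((IsUnit.of_mul_eq_one _ (wordOp_mul_self E)).mul
      (IsUnit.of_mul_eq_one _ (signedOp_mul_self g))).ne_zero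
  rw [commute_iff_eq, signedOp_mul_wordOp]
  rcases Int.units_eq_one_or (wordSign g.2 E) with h | h
  · simp [h]
  · simpa [h, Units.smul_def] using fun heq => hne (self_eq_neg.1 heq.symm)

end Pauli

section CodeSpace

open scoped Matrix

variable {n : ℕ} {S : Finset (SignedPauli n)}

lemma mem_centralizer_iff {z : PauliWord n} :
    z ∈ centralizer S ↔ ∀ g ∈ S, wordSign g.2 z = 1 := by
  simp only [← commute_signedOp_wordOp_iff]
  refine ⟨fun h g hg => h _ (Submonoid.subset_closure ⟨g, hg, rfl⟩), fun h g hg => ?_⟩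
  induction hg using Submonoid.closure_induction with
  | mem _ hx =>
    obtain ⟨g, hg, rfl⟩ := hx
    exact h g hg
  | one => exact Commute.one_left _
  | mul _ _ _ _ hx hy => exact hx.mul_left hy

lemma mem_codeSpace_iff {x : EuclideanSpace ℂ (Fin n → Fin 2)} :
    x ∈ codeSpace S ↔ ∀ g ∈ S, Matrix.toEuclideanLin (signedOp g) x = x := by
  simp only [codeSpace, Submodule.mem_iInf, Module.End.mem_eigenspace_iff, one_smul]
  refine ⟨fun h g hg => h _ (Submonoid.subset_closure ⟨g, hg, rfl⟩), fun h g hg => ?_⟩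
  induction hg using Submonoid.closure_induction with
  | mem _ hy =>
    obtain ⟨g, hg, rfl⟩ := hy
    exact h g hg
  | one => simp [Matrix.toLpLin_one]
  | mul a b _ _ ha hb => rw [Matrix.toLpLin_mul_same, LinearMap.comp_apply, hb, ha]

lemma toEuclideanLin_codeProj (x : EuclideanSpace ℂ (Fin n → Fin 2)) :
    Matrix.toEuclideanLin (codeProj S) x = (codeSpace S).starProjection x :=
  congrArg (fun f : _ →L[ℂ] _ => f x) <|
    (Matrix.toEuclideanCLM (n := Fin n → Fin 2) (𝕜 := ℂ)).apply_symm_apply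
      (codeSpace S).starProjection

lemma codeProj_mul_self (S : Finset (SignedPauli n)) : codeProj S * codeProj S = codeProj S := by
  rw [codeProj, ← map_mul, Submodule.isIdempotentElem_starProjection]

lemma conjTranspose_codeProj (S : Finset (SignedPauli n)) : (codeProj S)ᴴ = codeProj S := by
  rw [codeProj, ← Matrix.star_eq_conjTranspose]
  exact ((Matrix.toEuclideanCLM (n := Fin n → Fin 2) (𝕜 := ℂ)).symm.map_star' _).symm.trans
    (congrArg _ (isSelfAdjoint_starProjection (codeSpace S)).star_eq)

lemma codeProj_mul_eq_self_iff {A : QubitOp n} :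
    codeProj S * A = A ↔ ∀ g ∈ S, signedOp g * A = A := by
  simp only [← (Matrix.toEuclideanLin (𝕜 := ℂ)).injective.eq_iff, LinearMap.ext_iff,
    Matrix.toLpLin_mul_same, LinearMap.comp_apply, toEuclideanLin_codeProj,
    Submodule.starProjection_eq_self_iff, mem_codeSpace_iff]
  exact ⟨fun h g hg x => h x g hg, fun h x g hg => h g hg x⟩

lemma signedOp_mul_codeProj {g : SignedPauli n} (hg : g ∈ S) :
    signedOp g * codeProj S = codeProj S :=
  codeProj_mul_eq_self_iff.1 (codeProj_mul_self S) g hg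

lemma codeProj_mul_signedOp {g : SignedPauli n} (hg : g ∈ S) :
    codeProj S * signedOp g = codeProj S := by
  simpa [conjTranspose_codeProj, conjTranspose_signedOp] using
    congrArg Matrix.conjTranspose (signedOp_mul_codeProj hg)

lemma codeProj_mul_mul_codeProj_of_commute {A : QubitOp n}
    (hA : ∀ g ∈ S, Commute (signedOp g) A) : codeProj S * A * codeProj S = A * codeProj S := by
  rw [mul_assoc, codeProj_mul_eq_self_iff]
  intro g hg
  rw [← mul_assoc, (hA g hg).eq, mul_assoc, signedOp_mul_codeProj hg]

lemma codeProj_mul_mul_codeProj_of_anticommute {A : QubitOp n} {g : SignedPauli n} (hg : g ∈ S)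
    (hA : signedOp g * A = -(A * signedOp g)) : codeProj S * A * codeProj S = 0 := by
  have hneg : codeProj S * A * codeProj S = -(codeProj S * A * codeProj S) :=
    calc codeProj S * A * codeProj S
        = codeProj S * (signedOp g * A) * codeProj S := by
          rw [← mul_assoc, codeProj_mul_signedOp hg]
      _ = -(codeProj S * A * (signedOp g * codeProj S)) := by
          rw [hA, mul_neg, neg_mul, mul_assoc, mul_assoc, mul_assoc]
      _ = -(codeProj S * A * codeProj S) := by rw [signedOp_mul_codeProj hg]
  exact self_eq_neg.1 hneg

lemma trace_codeProj_ne_zero (hS : codeSpace S ≠ ⊥) : (codeProj S).trace ≠ 0 := by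
  intro htrace
  have hzero : codeProj S = 0 := by
    open scoped ComplexOrder in
    rw [← Matrix.trace_conjTranspose_mul_self_eq_zero_iff, conjTranspose_codeProj,
      codeProj_mul_self, htrace]
  refine hS ((Submodule.eq_bot_iff _).2 fun x hx => ?_)
  simpa [hzero, Submodule.starProjection_eq_self_iff.2 hx] using
    (toEuclideanLin_codeProj (S := S) x).symm

open Classical in
/-- The syndrome of a Pauli error: the set of the checks that it violates, that is, of the checks
with which it does not commute. -/
noncomputable def syndrome (S : Finset (SignedPauli n)) (E : PauliWord n) :
    Finset (SignedPauli n) :=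
  S.filter fun g => ¬ Commute (signedOp g) (wordOp E)

lemma mem_syndrome {E : PauliWord n} {g : SignedPauli n} :
    g ∈ syndrome S E ↔ g ∈ S ∧ wordSign g.2 E ≠ 1 := by
  simp [syndrome, commute_signedOp_wordOp_iff]

lemma syndrome_eq_iff {E F : PauliWord n} :
    syndrome S E = syndrome S F ↔ ∀ g ∈ S, wordSign g.2 E * wordSign g.2 F = 1 := by
  simp only [Finset.ext_iff, mem_syndrome, and_congr_right_iff]
  refine forall₂_congr fun g _ => ?_
  rcases Int.units_eq_one_or (wordSign g.2 E) with hE | hE <;>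
    rcases Int.units_eq_one_or (wordSign g.2 F) with hF | hF <;> simp [hE, hF]

lemma signedOp_mul_wordOp_mul_wordOp (g : SignedPauli n) (E F : PauliWord n) :
    signedOp g * (wordOp E * wordOp F) =
      (wordSign g.2 E * wordSign g.2 F) • (wordOp E * wordOp F * signedOp g) := by
  rw [← mul_assoc, signedOp_mul_wordOp, smul_mul_assoc, mul_assoc, signedOp_mul_wordOp,
    mul_smul_comm, smul_smul, mul_assoc]

lemma trace_conj_codeProj_mul_conj_codeProj (E F : PauliWord n) :
    (wordOp F * codeProj S * wordOp F * (wordOp E * codeProj S * wordOp E)).trace =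
      if syndrome S F = syndrome S E then (codeProj S).trace else 0 := by
  have hcyc : (wordOp F * codeProj S * wordOp F * (wordOp E * codeProj S * wordOp E)).trace =
      (codeProj S * (wordOp F * wordOp E) * codeProj S * (wordOp E * wordOp F)).trace := by
    rw [mul_assoc, mul_assoc, Matrix.trace_mul_comm]
    simp only [mul_assoc]
  rw [hcyc]
  split_ifs with h
  · have hcomm : ∀ g ∈ S, Commute (signedOp g) (wordOp F * wordOp E) := fun g hg => by
      rw [commute_iff_eq, signedOp_mul_wordOp_mul_wordOp, syndrome_eq_iff.1 h g hg, one_smul]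
    have hcancel : wordOp E * wordOp F * (wordOp F * wordOp E) = 1 := by
      rw [mul_assoc, ← mul_assoc (wordOp F), wordOp_mul_self, one_mul, wordOp_mul_self]
    rw [codeProj_mul_mul_codeProj_of_commute hcomm, Matrix.trace_mul_comm, ← mul_assoc, hcancel,
      one_mul]
  · obtain ⟨g, hg, hne⟩ : ∃ g ∈ S, wordSign g.2 F * wordSign g.2 E ≠ 1 := by
      simpa [syndrome_eq_iff] using h
    have hanti : signedOp g * (wordOp F * wordOp E) = -(wordOp F * wordOp E * signedOp g) := by
      rw [signedOp_mul_wordOp_mul_wordOp, (Int.units_eq_one_or _).resolve_left hne]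
      simp [Units.smul_def]
    rw [codeProj_mul_mul_codeProj_of_anticommute hg hanti, zero_mul, Matrix.trace_zero]

lemma hamiltonian_mul_wordOp_mul_codeProj (S : Finset (SignedPauli n)) (E : PauliWord n) :
    hamiltonian S * (wordOp E * codeProj S) =
      ((syndrome S E).card : ℂ) • (wordOp E * codeProj S) := by
  have hcheck : ∀ g ∈ S, (1 / 2 : ℂ) • (1 - signedOp g) * (wordOp E * codeProj S) =
      (if g ∈ syndrome S E then (1 : ℂ) else 0) • (wordOp E * codeProj S) := by
    intro g hg
    rw [smul_mul_assoc, sub_mul, one_mul, ← mul_assoc, signedOp_mul_wordOp, smul_mul_assoc,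
      mul_assoc, signedOp_mul_codeProj hg]
    rcases Int.units_eq_one_or (wordSign g.2 E) with hE | hE
    · simp [mem_syndrome, hE]
    · simp [mem_syndrome, hE, hg, Units.smul_def, smul_smul, ← two_smul ℂ]
  rw [hamiltonian, Finset.sum_mul, Finset.sum_congr rfl hcheck, ← Finset.sum_smul,
    Finset.sum_boole, Finset.filter_mem_eq_inter,
    Finset.inter_eq_right.2 fun g hg => (mem_syndrome.1 hg).1]

end CodeSpace

section Exp

attribute [local instance] Matrix.linftyOpNormedRing Matrix.linftyOpNormedAlgebra

lemma exp_mul_eq_smul_of_mul_eq_smul {m : Type*} [Fintype m] [DecidableEq m]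
    {A B : Matrix m m ℂ} {c : ℂ} (h : A * B = c • B) :
    NormedSpace.exp A * B = Complex.exp c • B := by
  have hsemi : SemiconjBy B (algebraMap ℂ (Matrix m m ℂ) c) A := by
    rw [SemiconjBy, h, ← Algebra.commutes, Algebra.smul_def]
  calc NormedSpace.exp A * B
      = B * NormedSpace.exp (algebraMap ℂ (Matrix m m ℂ) c) := hsemi.exp_right.eq.symm
    _ = B * algebraMap ℂ (Matrix m m ℂ) (Complex.exp c) := by
        rw [Complex.exp_eq_exp_ℂ]
        exact congrArg (B * ·) (NormedSpace.algebraMap_exp_comm c).symm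
    _ = Complex.exp c • B := by rw [← Algebra.commutes, Algebra.smul_def]

end Exp

section SyndromeLaw

open scoped ENNReal

lemma toReal_map_apply {A B : Type*} [Fintype A] [DecidableEq B] (p : PMF A) (f : A → B) (b : B) :
    (p.map f b).toReal = ∑ a, if f a = b then (p a).toReal else 0 := by
  have hfin : ∀ a ∈ Finset.univ, (if b = f a then p a else 0) ≠ ∞ := fun a _ => by
    split_ifs
    exacts [p.apply_ne_top a, ENNReal.zero_ne_top]
  simp only [PMF.map_apply, tsum_fintype]
  rw [ENNReal.toReal_sum (by convert hfin)]
  refine Finset.sum_congr rfl fun a _ => ?_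
  by_cases h : f a = b <;> simp [h, Ne.symm]

lemma toOuterMeasure_setOf_le_mul_comp_le {A : Type*} (p : PMF A) {f : A → A}
    (hf : f.Injective) (ρ : ℝ≥0∞) : p.toOuterMeasure {a | p a ≤ ρ * p (f a)} ≤ ρ := by
  calc p.toOuterMeasure {a | p a ≤ ρ * p (f a)}
      ≤ ∑' a, ρ * p (f a) := by
        rw [PMF.toOuterMeasure_apply]
        exact ENNReal.tsum_le_tsum fun a => Set.indicator_apply_le' id fun _ => zero_le
    _ ≤ ρ * ∑' a, p a := by
        rw [ENNReal.tsum_mul_left]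
        refine mul_le_mul_right ?_ ρ
        exact ENNReal.tsum_comp_le_tsum_of_injective hf p
    _ = ρ := by rw [p.tsum_coe, mul_one]

variable {n : ℕ} {S : Finset (SignedPauli n)} {β : ℝ} {μ : PMF (PauliWord n)}

lemma gibbs_mul_wordOp_mul_codeProj (S : Finset (SignedPauli n)) (β : ℝ) (E : PauliWord n) :
    gibbs S β * (wordOp E * codeProj S) =
      ((NormedSpace.exp (((-(β / energyDensity S) : ℝ) : ℂ) • hamiltonian S)).trace⁻¹ *
        (Real.exp (-(β / energyDensity S) * (syndrome S E).card) : ℂ)) •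
        (wordOp E * codeProj S) := by
  have heigen : (((-(β / energyDensity S) : ℝ) : ℂ) • hamiltonian S) * (wordOp E * codeProj S) =
      ((-(β / energyDensity S) * (syndrome S E).card : ℝ) : ℂ) • (wordOp E * codeProj S) := by
    rw [smul_mul_assoc, hamiltonian_mul_wordOp_mul_codeProj, smul_smul]
    norm_cast
  rw [gibbs, smul_mul_assoc, exp_mul_eq_smul_of_mul_eq_smul heigen, smul_smul,
    Complex.ofReal_exp]

lemma toReal_map_syndrome_apply (hS : codeSpace S ≠ ⊥) (hμ : IsGibbsErrorLaw S β μ)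
    (E : PauliWord n) :
    ((μ.map (syndrome S) (syndrome S E)).toReal : ℂ) =
      (NormedSpace.exp (((-(β / energyDensity S) : ℝ) : ℂ) • hamiltonian S)).trace⁻¹ *
        (Real.exp (-(β / energyDensity S) * (syndrome S E).card) : ℂ) * (codeProj S).trace := by
  classical
  have hterm : ∀ F : PauliWord n, ((((μ F).toReal : ℝ) : ℂ) •
      (wordOp F * codeState S * wordOp F) * (wordOp E * codeProj S * wordOp E)).trace =
      ((if syndrome S F = syndrome S E then (μ F).toReal else 0 : ℝ) : ℂ) := by
    intro F
    rw [codeState, mul_smul_comm, smul_mul_assoc, smul_mul_assoc, smul_mul_assoc,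
      Matrix.trace_smul, Matrix.trace_smul, trace_conj_codeProj_mul_conj_codeProj]
    split_ifs <;> simp [trace_codeProj_ne_zero hS]
  calc ((μ.map (syndrome S) (syndrome S E)).toReal : ℂ)
      = (gibbs S β * (wordOp E * codeProj S * wordOp E)).trace := by
        rw [← hμ.2, Finset.sum_mul, Matrix.trace_sum, Finset.sum_congr rfl fun F _ => hterm F,
          toReal_map_apply, Complex.ofReal_sum]
    _ = _ := by
        rw [← mul_assoc, gibbs_mul_wordOp_mul_codeProj, smul_mul_assoc, Matrix.trace_smul,
          Matrix.trace_mul_comm, ← mul_assoc, wordOp_mul_self, one_mul, smul_eq_mul]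

lemma map_syndrome_apply_eq_exp_mul (hS : codeSpace S ≠ ⊥) (hμ : IsGibbsErrorLaw S β μ)
    {E F : PauliWord n} {k : ℕ} (hk : (syndrome S E).card = (syndrome S F).card + k) :
    μ.map (syndrome S) (syndrome S E) =
      ENNReal.ofReal (Real.exp (-(β / energyDensity S) * k)) *
        μ.map (syndrome S) (syndrome S F) := by
  have hreal : (μ.map (syndrome S) (syndrome S E)).toReal =
      Real.exp (-(β / energyDensity S) * k) * (μ.map (syndrome S) (syndrome S F)).toReal := by
    apply Complex.ofReal_injective
    rw [Complex.ofReal_mul, toReal_map_syndrome_apply hS hμ, toReal_map_syndrome_apply hS hμ, hk,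
      Nat.cast_add, mul_add, Real.exp_add, Complex.ofReal_mul]
    ring
  rw [← ENNReal.ofReal_toReal (PMF.apply_ne_top _ (syndrome S E)), hreal,
    ENNReal.ofReal_mul (Real.exp_nonneg _), ENNReal.ofReal_toReal (PMF.apply_ne_top _ _)]

end SyndromeLaw

section Errors

open Finset

variable {n : ℕ} {S : Finset (SignedPauli n)} {E : PauliWord n}

lemma mem_supp_indicator {s : Set (Fin n)} {i : Fin n} :
    i ∈ supp (s.indicator E) ↔ i ∈ s ∧ i ∈ supp E := by
  simp [mem_supp]

lemma supp_indicator (T : Finset (Fin n)) (E : PauliWord n) :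
    supp ((T : Set (Fin n)).indicator E) = T ∩ supp E := by
  ext i
  rw [mem_supp_indicator, mem_coe, mem_inter]

lemma wt_indicator_add_wt_indicator_compl (s : Set (Fin n)) (E : PauliWord n) :
    wt (s.indicator E) + wt (sᶜ.indicator E) = wt E := by
  classical
  rw [wt, wt, wt, ← card_filter_add_card_filter_not (s := supp E) (· ∈ s)]
  congr 2 <;> ext i <;> simp [mem_supp_indicator, and_comm]

lemma wt_add_le (E F : PauliWord n) : wt (E + F) ≤ wt E + wt F := by
  refine (card_le_card fun i hi => ?_).trans (card_union_le (supp E) (supp F))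
  contrapose! hi
  simp_all [mem_supp]

lemma isMinimalError_iff : IsMinimalError S E ↔ ∀ z ∈ centralizer S, wt E ≤ wt (E + z) := by
  have hzero : (0 : PauliWord n) ∈ centralizer S :=
    mem_centralizer_iff.2 fun g _ => wordSign_eq_one_of_disjoint (by simp [supp])
  refine ⟨fun h z hz => h.trans_le (Nat.sInf_le ⟨z, hz, rfl⟩), fun h => le_antisymm ?_ ?_⟩
  · refine le_csInf ⟨_, 0, hzero, rfl⟩ ?_
    rintro _ ⟨z, hz, rfl⟩
    exact h z hz
  · exact Nat.sInf_le ⟨0, hzero, by simp⟩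

lemma IsMinimalError.indicator (hE : IsMinimalError S E) (s : Set (Fin n)) :
    IsMinimalError S (s.indicator E) := by
  rw [isMinimalError_iff] at hE ⊢
  intro z hz
  have hmin := hE z hz
  have hsplit : E + z = (s.indicator E + z) + sᶜ.indicator E := by
    rw [add_right_comm, Set.indicator_self_add_compl]
  rw [hsplit, ← wt_indicator_add_wt_indicator_compl s E] at hmin
  exact Nat.le_of_add_le_add_right (hmin.trans (wt_add_le _ _))

lemma syndrome_add [DecidableEq (SignedPauli n)] (E F : PauliWord n) :
    syndrome S (E + F) = symmDiff (syndrome S E) (syndrome S F) := by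
  ext g
  rw [mem_symmDiff]
  simp only [mem_syndrome, wordSign_add_right]
  rcases Int.units_eq_one_or (wordSign g.2 E) with hE | hE <;>
    rcases Int.units_eq_one_or (wordSign g.2 F) with hF | hF <;> simp [hE, hF]

lemma not_disjoint_supp_of_mem_syndrome {g : SignedPauli n} (hg : g ∈ syndrome S E) :
    ¬ Disjoint (supp g.2) (supp E) :=
  fun h => (mem_syndrome.1 hg).2 (wordSign_eq_one_of_disjoint h)

lemma disjoint_syndrome_indicator {s : Set (Fin n)}
    (hs : ∀ u ∈ s, ∀ w ∈ supp E, w ∉ s → ¬ (interactionGraph S).Adj u w) :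
    Disjoint (syndrome S (s.indicator E)) (syndrome S (sᶜ.indicator E)) := by
  refine Finset.disjoint_left.2 fun g hg hgc => ?_
  obtain ⟨u, hug, hu⟩ := not_disjoint_iff.1 (not_disjoint_supp_of_mem_syndrome hg)
  obtain ⟨w, hwg, hw⟩ := not_disjoint_iff.1 (not_disjoint_supp_of_mem_syndrome hgc)
  rw [mem_supp_indicator] at hu hw
  exact hs u hu.1 w hw.2 hw.1
    ⟨fun h => hw.1 (h ▸ hu.1), g, (mem_syndrome.1 hg).1, hug, hwg⟩

lemma card_filter_supp_subset (T : Finset (Fin n)) :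
    #{F : PauliWord n | supp F ⊆ T} = 4 ^ #T := by
  have hpi : ({F : PauliWord n | supp F ⊆ T} : Finset _) =
      Fintype.piFinset fun i => if i ∈ T then univ else {0} := by
    ext F
    simp only [mem_filter_univ, Fintype.mem_piFinset, subset_iff, mem_supp]
    refine forall_congr' fun i => ?_
    by_cases hi : i ∈ T <;> simp [hi]
  simp [hpi, apply_ite card]

lemma card_filter_mem_supp_le [(interactionGraph S).LocallyFinite] {D : ℕ} {v : Fin n}
    (hv : (interactionGraph S).degree v ≤ D) : #{g ∈ S | v ∈ supp g.2} ≤ 2 * 4 ^ (D + 1) := by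
  set N := insert v ((interactionGraph S).neighborFinset v) with hN
  have hsub : {g ∈ S | v ∈ supp g.2} ⊆ univ ×ˢ ({F | supp F ⊆ N} : Finset (PauliWord n)) := by
    intro g hg
    obtain ⟨hgS, hgv⟩ := mem_filter.1 hg
    simp only [mem_product, mem_univ, mem_filter, true_and]
    intro i hi
    rw [hN, mem_insert, SimpleGraph.mem_neighborFinset]
    exact or_iff_not_imp_left.2 fun hiv => ⟨Ne.symm hiv, g, hgS, hgv, hi⟩
  calc #{g ∈ S | v ∈ supp g.2}
      ≤ #(univ : Finset ℤˣ) * #{F : PauliWord n | supp F ⊆ N} :=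
        (card_le_card hsub).trans_eq (card_product _ _)
    _ = 2 * 4 ^ #N := by rw [card_filter_supp_subset, card_univ, Fintype.card_units_int]
    _ ≤ 2 * 4 ^ (D + 1) := by
        gcongr
        · norm_num
        · exact (card_insert_le _ _).trans (Nat.succ_le_succ hv)

/-- Linear soundness of the set of checks `S` with constant `κ`: an error of minimal weight
violates at least `κ` checks per unit of weight. Unlike the soundness in `IsSLTC`, this one is not
normalized by the number of checks. -/
def IsLinearlySound (S : Finset (SignedPauli n)) (κ : ℝ) : Prop :=
  ∀ P : PauliWord n, IsMinimalError S P → κ * wt P ≤ #(syndrome S P)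

lemma IsSLTC.isLinearlySound {q : ℕ} {s : ℝ} (h : IsSLTC S q s) :
    IsLinearlySound S (s * energyDensity S) := by
  intro P hP
  have hsound : (wt P : ℝ) / n * s ≤ #(syndrome S P) / #S := hP ▸ h.2.2 P
  rcases (#S).eq_zero_or_pos with hS | hS
  · simp [energyDensity, hS]
  · rw [le_div_iff₀ (by exact_mod_cast hS)] at hsound
    calc s * energyDensity S * wt P = wt P / n * s * #S := by rw [energyDensity]; ring
      _ ≤ #(syndrome S P) := hsound

lemma IsLinearlySound.le_of_degree_le [(interactionGraph S).LocallyFinite] {κ : ℝ} {D : ℕ}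
    {v : Fin n} (hκ : IsLinearlySound S κ) (hE : IsMinimalError S E) (hvE : v ∈ supp E)
    (hv : (interactionGraph S).degree v ≤ D) : κ ≤ 2 * 4 ^ (D + 1) := by
  set F := (({v} : Finset (Fin n)) : Set (Fin n)).indicator E with hF
  have hsupp : supp F = {v} := by rw [hF, supp_indicator, singleton_inter_of_mem hvE]
  have hsub : syndrome S F ⊆ {g ∈ S | v ∈ supp g.2} := fun g hg => by
    have hgF := not_disjoint_supp_of_mem_syndrome hg
    rw [hsupp, disjoint_singleton_right, not_not] at hgF
    exact mem_filter.2 ⟨(mem_syndrome.1 hg).1, hgF⟩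
  calc κ = κ * wt F := by rw [wt, hsupp, card_singleton, Nat.cast_one, mul_one]
    _ ≤ #(syndrome S F) := hκ F (hE.indicator _)
    _ ≤ 2 * 4 ^ (D + 1) := by
        exact_mod_cast (card_le_card hsub).trans (card_filter_mem_supp_le hv)

end Errors

section Peierls

open Finset

variable {n : ℕ} {S : Finset (SignedPauli n)} {α β κ : ℝ} {μ : PMF (PauliWord n)}

lemma map_syndrome_apply_le_of_not_adj [DecidableEq (SignedPauli n)] (hS : codeSpace S ≠ ⊥)
    (hμ : IsGibbsErrorLaw S β μ) (hβ : 0 ≤ β / energyDensity S) (hκ : IsLinearlySound S κ)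
    (hκ₀ : 0 ≤ κ) {E : PauliWord n} (hE : IsMinimalError S E) {T : Finset (Fin n)}
    (hTα : IsAlphaSubset α (supp E) T)
    (hT : ∀ u ∈ T, ∀ w ∈ supp E, w ∉ T → ¬ (interactionGraph S).Adj u w) :
    μ.map (syndrome S) (syndrome S E) ≤
      ENNReal.ofReal (Real.exp (-(β / energyDensity S * κ * α)) ^ #T) *
        μ.map (syndrome S)
          (symmDiff (syndrome S E) (syndrome S ((T : Set (Fin n)).indicator E))) := by
  set F := (T : Set (Fin n)).indicator E with hF
  set F' := (T : Set (Fin n))ᶜ.indicator E with hF'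
  have hdisj : Disjoint (syndrome S F) (syndrome S F') := disjoint_syndrome_indicator hT
  have hsyn : syndrome S E = symmDiff (syndrome S F) (syndrome S F') := by
    rw [← syndrome_add, hF, hF', Set.indicator_self_add_compl]
  have hcard : #(syndrome S E) = #(syndrome S F') + #(syndrome S F) := by
    rw [hsyn, hdisj.symmDiff_eq_sup, sup_eq_union, card_union_of_disjoint hdisj, add_comm]
  have hviolated : κ * (α * #T) ≤ #(syndrome S F) :=
    calc κ * (α * #T) ≤ κ * wt F := by
          rw [hF, wt, supp_indicator]
          exact mul_le_mul_of_nonneg_left hTα hκ₀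
      _ ≤ #(syndrome S F) := hκ F (hE.indicator _)
  have hexp : Real.exp (-(β / energyDensity S) * #(syndrome S F)) ≤
      Real.exp (-(β / energyDensity S * κ * α)) ^ #T := by
    rw [← Real.exp_nat_mul, Real.exp_le_exp]
    linarith [mul_le_mul_of_nonneg_left hviolated hβ]
  have hremoved : symmDiff (syndrome S E) (syndrome S F) = syndrome S F' := by
    rw [hsyn, symmDiff_comm, symmDiff_symmDiff_cancel_left]
  rw [hremoved, map_syndrome_apply_eq_exp_mul hS hμ hcard]
  gcongr

theorem toOuterMeasure_lt_maxconn_le (hS : codeSpace S ≠ ⊥) (hμ : IsGibbsErrorLaw S β μ)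
    (hβ : 0 ≤ β / energyDensity S) (hκ : IsLinearlySound S κ) (hκ₀ : 0 ≤ κ) {L : ℝ}
    (hL : 0 ≤ L) :
    μ.toOuterMeasure {E | L < (maxconn (interactionGraph S) α (supp E) : ℝ)} ≤
      ENNReal.ofReal (∑ T ∈ connectedSets (interactionGraph S) with L < (#T : ℝ),
        (4 * Real.exp (-(β / energyDensity S * κ * α))) ^ #T) := by
  classical
  set x := Real.exp (-(β / energyDensity S * κ * α))
  set I := {T ∈ connectedSets (interactionGraph S) | L < (#T : ℝ)}
  let words (T : Finset (Fin n)) : Finset (PauliWord n) := {F | supp F ⊆ T}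
  let shiftable (T : Finset (Fin n)) (F : PauliWord n) : Set (Finset (SignedPauli n)) :=
    {c | μ.map (syndrome S) c ≤
      ENNReal.ofReal (x ^ #T) * μ.map (syndrome S) (symmDiff c (syndrome S F))}
  have hcover : {E | L < (maxconn (interactionGraph S) α (supp E) : ℝ)} ∩ μ.support ⊆
      ⋃ T ∈ I, ⋃ F ∈ words T, syndrome S ⁻¹' shiftable T F := by
    rintro E ⟨hbad, hE⟩
    obtain ⟨T, hTL, hT⟩ := exists_maximal_of_lt_maxconn hL hbad
    refine Set.mem_biUnion (mem_filter.2 ⟨hT.prop.1, hTL⟩) <|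
      Set.mem_biUnion (x := (T : Set (Fin n)).indicator E) ?_ ?_
    · simp [words, supp_indicator]
    · exact map_syndrome_apply_le_of_not_adj hS hμ hβ hκ hκ₀ (hμ.1 E hE) hT.prop.2
        fun u hu w hw hwT => not_adj_of_maximal hT hu hw hwT
  calc μ.toOuterMeasure {E | L < (maxconn (interactionGraph S) α (supp E) : ℝ)}
      ≤ ∑ T ∈ I, ∑ F ∈ words T, μ.toOuterMeasure (syndrome S ⁻¹' shiftable T F) :=
        (μ.toOuterMeasure_mono hcover).trans <| (MeasureTheory.measure_biUnion_finset_le _ _).trans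
          <| sum_le_sum fun T _ => MeasureTheory.measure_biUnion_finset_le _ _
    _ ≤ ∑ T ∈ I, ∑ _F ∈ words T, ENNReal.ofReal (x ^ #T) := by
        gcongr with T _ _ _
        rw [← PMF.toOuterMeasure_map_apply]
        exact toOuterMeasure_setOf_le_mul_comp_le _ (symmDiff_left_injective _) _
    _ = ENNReal.ofReal (∑ T ∈ I, (4 * x) ^ #T) := by
        rw [ENNReal.ofReal_sum_of_nonneg fun T _ => by positivity]
        refine sum_congr rfl fun T _ => ?_
        rw [sum_const, card_filter_supp_subset, nsmul_eq_mul, mul_pow,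
          ENNReal.ofReal_mul (by positivity)]
        norm_num

end Peierls

section TailBound

open Finset

lemma four_mul_exp_mul_sq_le {d b : ℝ} (hd : 100 ≤ Real.log d) (hd₀ : 0 < d)
    (hb : 10 * Real.log d ≤ b) : 4 * Real.exp (-b) * d ^ 2 ≤ Real.exp (-500) := by
  have hfour : (4 : ℝ) ≤ Real.exp 3 := by linarith [Real.add_one_le_exp (3 : ℝ)]
  have hsq : d ^ 2 = Real.exp (2 * Real.log d) := by
    rw [two_mul, Real.exp_add, Real.exp_log hd₀, sq]
  calc 4 * Real.exp (-b) * d ^ 2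
      ≤ Real.exp 3 * Real.exp (-b) * Real.exp (2 * Real.log d) := by rw [hsq]; gcongr
    _ = Real.exp (3 + -b + 2 * Real.log d) := by rw [Real.exp_add, Real.exp_add]
    _ ≤ Real.exp (-500) := Real.exp_le_exp.2 (by linarith)

variable {n D : ℕ} {S : Finset (SignedPauli n)} {α β κ : ℝ} {μ : PMF (PauliWord n)}

theorem toOuterMeasure_log_lt_maxconn_le [(interactionGraph S).LocallyFinite]
    (hn : 0 < n) (hS : codeSpace S ≠ ⊥)
    (hμ : IsGibbsErrorLaw S β μ) (hβ : 0 ≤ β / energyDensity S) (hκ : IsLinearlySound S κ)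
    (hκ₀ : 0 ≤ κ) (hG : ∀ v, (interactionGraph S).degree v ≤ D) (hD : 100 ≤ Real.log D)
    (hDβ : 10 * Real.log D ≤ β / energyDensity S * κ * α) :
    μ.toOuterMeasure
        {E | Real.log n / 100 < (maxconn (interactionGraph S) α (supp E) : ℝ)} ≤
      ENNReal.ofReal ((n : ℝ) ^ (-3 : ℤ)) := by
  have hn' : (0 : ℝ) < n := by exact_mod_cast hn
  have hD₀ : 0 < D := by
    rcases D.eq_zero_or_pos with rfl | h
    · norm_num at hD
    · exact h
  refine (toOuterMeasure_lt_maxconn_le hS hμ hβ hκ hκ₀ ?_).trans (ENNReal.ofReal_le_ofReal ?_)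
  · exact div_nonneg (Real.log_natCast_nonneg n) (by norm_num)
  set x := 4 * Real.exp (-(β / energyDensity S * κ * α))
  have hdecay : ∀ t : ℕ, Real.log n / 100 < t → (x * D ^ 2) ^ t ≤ (n : ℝ) ^ (-5 : ℤ) := by
    intro t ht
    calc (x * D ^ 2) ^ t ≤ Real.exp (-500) ^ t := by
          gcongr
          exact four_mul_exp_mul_sq_le hD (by exact_mod_cast hD₀) hDβ
      _ = Real.exp (t * -500) := (Real.exp_nat_mul _ _).symm
      _ ≤ Real.exp (Real.log n * (-5 : ℤ)) := Real.exp_le_exp.2 (by push_cast; linarith)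
      _ = (n : ℝ) ^ (-5 : ℤ) := by rw [← Real.rpow_def_of_pos hn', Real.rpow_intCast]
  calc ∑ T ∈ connectedSets (interactionGraph S) with Real.log n / 100 < (#T : ℝ), x ^ #T
      ≤ (n : ℝ) ^ (-5 : ℤ) * Fintype.card (Fin n) ^ 2 :=
        sum_connectedSets_pow_le hG hD₀ (by positivity) (by positivity) hdecay
    _ = (n : ℝ) ^ (-3 : ℤ) := by
        rw [Fintype.card_fin, ← zpow_natCast, ← zpow_add₀ hn'.ne']
        norm_num

lemma IsLinearlySound.le_of_lt_maxconn [(interactionGraph S).LocallyFinite]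
    (hκ : IsLinearlySound S κ) (hκ₀ : 0 ≤ κ) (hG : ∀ v, (interactionGraph S).degree v ≤ D)
    (hα : 0 < α) {b ℓ : ℝ} (hb : 0 ≤ b) (hbℓ : b * ℓ ≤ 1) (hDb : 10 * Real.log D ≤ b * κ * α)
    {E : PauliWord n} (hE : IsMinimalError S E) {L : ℝ} (hL : 2 ≤ L)
    (h : L < (maxconn (interactionGraph S) α (supp E) : ℝ)) : ℓ ≤ 2 * 4 ^ (D + 1) := by
  obtain ⟨T, hTL, hT⟩ := exists_maximal_of_lt_maxconn (zero_le_two.trans hL) h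
  obtain ⟨hTc, hTα⟩ := hT.prop
  have hD : 2 ≤ D := by
    by_contra! hlt
    have hT₂ := card_le_two_of_mem_connectedSets (fun v => (hG v).trans (by omega)) hTc
    have : (#T : ℝ) ≤ 2 := by exact_mod_cast hT₂
    linarith
  have hlogD : 1 ≤ 10 * Real.log D := by
    have : Real.log 2 ≤ Real.log D := Real.log_le_log two_pos (by exact_mod_cast hD)
    linarith [Real.log_two_gt_d9]
  have hbκ : 1 ≤ b * κ := (hlogD.trans hDb).trans <|
    mul_le_of_le_one_right (by positivity) (hTα.le_one (nonempty_of_mem_connectedSets hTc))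
  obtain ⟨v, hv⟩ : (T ∩ supp E).Nonempty := by
    have hTpos : (0 : ℝ) < #T := by linarith
    exact card_pos.1 (Nat.cast_pos.1 ((mul_pos hα hTpos).trans_le hTα))
  have hκD : κ ≤ 2 * 4 ^ (D + 1) := hκ.le_of_degree_le hE (mem_inter.1 hv).2 (hG v)
  have hbℓκ : 0 ≤ κ * (1 - b * ℓ) := mul_nonneg hκ₀ (by linarith)
  rcases le_or_gt ℓ 0 with hℓ | hℓ
  · exact hℓ.trans (by positivity)
  · nlinarith

end TailBound

section Temperature

variable {n D : ℕ} {S : Finset (SignedPauli n)} {s α β ℓ : ℝ}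

lemma energyDensity_nonneg (S : Finset (SignedPauli n)) : 0 ≤ energyDensity S := by
  rw [energyDensity]
  positivity

lemma nonneg_of_mul_log_div_le (hs : 0 < s) (hα : 0 < α) (h : 10 / α * Real.log D / s ≤ β) :
    0 ≤ β := by
  have := Real.log_natCast_nonneg D
  exact le_trans (by positivity) h

lemma div_energyDensity_mul_le_one (hℓ : 0 < ℓ) (h : β ≤ energyDensity S / ℓ) :
    β / energyDensity S * ℓ ≤ 1 := by
  rw [div_mul_eq_mul_div]
  exact div_le_one_of_le₀ ((le_div_iff₀ hℓ).1 h) (energyDensity_nonneg S)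

lemma mul_log_le_div_energyDensity_mul (hs : 0 < s) (hα : 0 < α) (hβ : 10 / α * Real.log D / s ≤ β)
    (hβ' : β ≤ energyDensity S / ℓ) :
    10 * Real.log D ≤ β / energyDensity S * (s * energyDensity S) * α := by
  have hscale : β / energyDensity S * (s * energyDensity S) = β * s := by
    rcases (energyDensity_nonneg S).eq_or_lt with h | h
    · rw [← h, zero_div] at hβ'
      rw [← h, hβ'.antisymm (nonneg_of_mul_log_div_le hs hα hβ)]
      simp
    · field_simp
  rw [hscale, mul_comm β s]
  rw [div_le_iff₀ hs, div_mul_eq_mul_div, div_le_iff₀ hα] at hβ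
  linarith

lemma le_log_of_two_mul_four_pow_lt {x : ℝ}
    (h : (2 : ℝ) * 4 ^ (⌈Real.exp x⌉₊ + 1) < 2 * 4 ^ (D + 1)) : x ≤ Real.log D := by
  have hexp : ⌈Real.exp x⌉₊ < D := by
    have := (pow_lt_pow_iff_right₀ (by norm_num)).1 (lt_of_mul_lt_mul_left h zero_le_two)
    omega
  have hD : (0 : ℝ) < D := mod_cast hexp.pos
  exact (Real.le_log_iff_exp_le hD).2 ((Nat.le_ceil _).trans (mod_cast hexp.le))

end Temperature

end ThermalLTC

theorem mainTheorem2 :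
    ∃ n₀ : ℕ, ∀ (n : ℕ), n₀ ≤ n →
      ∀ (S : Finset (ThermalLTC.SignedPauli n)) (q : ℕ) (s : ℝ) (D : ℕ) (α β : ℝ),
        0 < s →
        ThermalLTC.IsSLTC S q s →
        (∀ v : Fin n, ((ThermalLTC.interactionGraph S).neighborSet v).ncard ≤ D) →
        0 < α →
        (10 / α) * Real.log D / s ≤ β →
        β ≤ ThermalLTC.energyDensity S / Real.log n →
        ∀ μ : PMF (ThermalLTC.PauliWord n), ThermalLTC.IsGibbsErrorLaw S β μ →
          μ.toOuterMeasure
              {E | Real.log n / 100 <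
                (ThermalLTC.maxconn (ThermalLTC.interactionGraph S) α (ThermalLTC.supp E) : ℝ)} ≤
            ENNReal.ofReal ((n : ℝ) ^ (-3 : ℤ)) := by
  classical
  obtain ⟨n₀, hn₀⟩ : ∃ n₀ : ℕ, ∀ n ≥ n₀, max 200 (2 * 4 ^ (⌈Real.exp 100⌉₊ + 1)) < Real.log n :=
    Filter.eventually_atTop.1 <|
      (Real.tendsto_log_atTop.comp tendsto_natCast_atTop_atTop).eventually_gt_atTop _
  refine ⟨n₀, fun n hn S q s D α β hs hS hdeg hα hβ hβlog μ hμ => ?_⟩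
  obtain ⟨hlog, hlogexp⟩ := max_lt_iff.1 (hn₀ n hn)
  have hlogpos : 0 < Real.log n := by linarith
  have hnpos : 0 < n := Nat.pos_of_ne_zero fun h => by simp [h] at hlogpos
  have hb : 0 ≤ β / ThermalLTC.energyDensity S :=
    div_nonneg (ThermalLTC.nonneg_of_mul_log_div_le hs hα hβ) (ThermalLTC.energyDensity_nonneg S)
  have hbκ := ThermalLTC.mul_log_le_div_energyDensity_mul hs hα hβ hβlog
  have hκ := mul_nonneg hs.le (ThermalLTC.energyDensity_nonneg S)
  have hG (v : Fin n) : (ThermalLTC.interactionGraph S).degree v ≤ D :=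
    (Set.ncard_eq_toFinset_card' _).symm.trans_le (hdeg v)
  by_cases hbad : ∃ E ∈ μ.support, Real.log n / 100 <
      (ThermalLTC.maxconn (ThermalLTC.interactionGraph S) α (ThermalLTC.supp E) : ℝ)
  · obtain ⟨E, hE, hEbad⟩ := hbad
    have hlogD : Real.log n ≤ 2 * 4 ^ (D + 1) :=
      hS.isLinearlySound.le_of_lt_maxconn hκ hG hα hb
        (ThermalLTC.div_energyDensity_mul_le_one hlogpos hβlog) hbκ (hμ.1 E hE) (by linarith) hEbad
    exact ThermalLTC.toOuterMeasure_log_lt_maxconn_le hnpos hS.1.2 hμ hb hS.isLinearlySound hκ hG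
      (ThermalLTC.le_log_of_two_mul_four_pow_lt (hlogexp.trans_le hlogD)) hbκ
  · exact ((PMF.toOuterMeasure_apply_eq_zero_iff _ _).2 <|
      Set.disjoint_left.2 fun E hE hEbad => hbad ⟨E, hE, hEbad⟩).trans_le bot_le
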